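/- Let $H$ be a real Hilbert space, $\lambda\ge 0$, and let $\Phi:H\to(-\infty,+\infty]$ be lower semicontinuous, proper (i.e. $\operatorname{dom}(\Phi):=\{x\in H:\Phi(x)\ne+\infty\}\neq\emptyset$) and $\lambda$-convex, i.e. for all $x,y\in H$ and $t\in[0,1]$, $$\Phi(tx+(1-t)y)\le t\Phi(x)+(1-t)\Phi(y)-\tfrac12\lambda t(1-t)\|x-y\|^2 ,$$ with the convention $0\cdot(+\infty)=0$. Let $x_0\in\overline{\operatorname{dom}(\Phi)}$ and let $u:(0,+\infty)\to H$ be the gradient flow of $\Phi$ starting at $x_0$, i.e. $u$ is locally absolutely continuous, $u(t)\to x_0$ as $t\downarrow 0$, and for a.e. $t>0$ and all $v\in H$ the derivative below exists and $$\tfrac12\tfrac{d}{dt}\|u(t)-v\|^2+\tfrac12\lambda\|u(t)-v\|^2+\Phi(u(t))\le\Phi(v).$$ For $t>0$ put $\kappa(t,\lambda):=\frac{e^{2\lambda t}-1}{2\lambda}$ if $\lambda\neq0$, and $\kappa(t,0):=t$. Then $\Phi(u(t))<+\infty$ for all $t>0$, and for all $x\in H$ and all $t>0$, $$\Phi(u(t))-\Phi(x)\le\frac{1}{2\kappa(t,\lambda)}\|x_0-x\|^2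 ,$$ where $\kappa(t,\lambda)\to+\infty$ as $t\to+\infty$. In particular, if $\Phi$ has a (global) minimum at $x_*\in H$, then $\Phi(u(t))\to\Phi(x_*)$ as $t\to+\infty$. -/

import Mathlib

open Set Filter Topology MeasureTheory

/-- The effective domain of an extended-real-valued function. -/
def effDom {H : Type*} (Φ : H → EReal) : Set H := {x | Φ x ≠ ⊤}

/-- `Φ` is proper if its effective domain is nonempty. That `Φ` takes its values in `(-∞, +∞]`
is always stated separately, as `∀ x, Φ x ≠ ⊥`. -/
def IsProperFun {H : Type*} (Φ : H → EReal) : Prop := (effDom Φ).Nonempty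

/-- `lam`-convexity of a function with values in `(-∞, +∞]` on a real Hilbert space. The convention
`0 * (+∞) = 0` is in force, so that the cases `t = 0` and `t = 1` are trivial. -/
def LambdaConvex {H : Type*} [NormedAddCommGroup H] [InnerProductSpace ℝ H]
    (lam : ℝ) (Φ : H → EReal) : Prop :=
  ∀ x y : H, ∀ t ∈ Icc (0 : ℝ) 1,
    Φ (t • x + (1 - t) • y) ≤
      (t : EReal) * Φ x + ((1 - t : ℝ) : EReal) * Φ y
        - ((1 / 2 * lam * t * (1 - t) * ‖x - y‖ ^ 2 : ℝ) : EReal)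

/-- The curve `u : (0, +∞) → H` (a function on `ℝ` of which only the restriction to `(0, +∞)` is
used) is a gradient flow of the `lam`-convex function `Φ` starting at `x₀`. -/
structure IsGradientFlow {H : Type*} [NormedAddCommGroup H] [InnerProductSpace ℝ H]
    (lam : ℝ) (Φ : H → EReal) (x₀ : H) (u : ℝ → H) : Prop where
  /-- `u` is locally absolutely continuous on `(0, +∞)`. -/
  locallyAC : ∀ a b : ℝ, 0 < a → a ≤ b → AbsolutelyContinuousOnInterval u a b
  /-- `u` has the initial value `x₀`. -/
  initial : Tendsto u (𝓝[>] 0) (𝓝 x₀)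
  /-- The evolution variational inequality, where `d` is the derivative of `‖u - v‖²` at `t`. -/
  evi : ∀ᵐ t ∂(volume.restrict (Ioi (0 : ℝ))), ∀ v : H, ∃ d : ℝ,
    HasDerivAt (fun s : ℝ => ‖u s - v‖ ^ 2) d t ∧
      ((1 / 2 * d + 1 / 2 * lam * ‖u t - v‖ ^ 2 : ℝ) : EReal) + Φ (u t) ≤ Φ v

open Classical in
/-- `κ(t, s) = (e^{2 s t} - 1) / (2 s)` for `s ≠ 0`, and `κ(t, 0) = t`. -/
noncomputable def kappa (t s : ℝ) : ℝ :=
  if s = 0 then t else (Real.exp (2 * s * t) - 1) / (2 * s)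

open scoped RealInnerProductSpace

/-! Fix `x` in the domain and put `E(r) = Φ(u r) - Φ(x)`. Discarding its `lam`-term, the evolution
inequality gives `(‖u - x‖²/2)' ≤ -E`. If moreover `E(t) exp(2 lam (t - r)) ≤ E(r)` for `r < t`,
integration over `(0, t)` yields `E(t) κ(t, lam) ≤ ‖x₀ - x‖²/2`.

The exponential decay (`energy_gap_mul_exp_le`) rests on energy dissipation. At almost every time
`u` has a weak derivative `w`, and `-w` is a subgradient of `Φ` at `u` with quadratic gain `lam/2`.
This gives both `E' ≤ -‖w‖²` wherever `E` is differentiable and, by completing a square, `2 lam E ≤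
‖w‖²`; hence `E' ≤ -2 lam E`. As `E` is only known to be nonincreasing, Grönwall's inequality is
needed for monotone functions. -/

/-! ### Absolutely continuous and monotone real functions -/

theorem AbsolutelyContinuousOnInterval.norm {E : Type*} [NormedAddCommGroup E] {f : ℝ → E}
    {a b : ℝ} (hf : AbsolutelyContinuousOnInterval f a b) :
    AbsolutelyContinuousOnInterval (fun x => ‖f x‖) a b :=
  squeeze_zero (fun _ => Finset.sum_nonneg fun _ _ => dist_nonneg)
    (fun _ => Finset.sum_le_sum fun _ _ => by
      rw [Real.dist_eq, dist_eq_norm]; exact abs_norm_sub_norm_le _ _) hf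

theorem AbsolutelyContinuousOnInterval.const {E : Type*} [NormedAddCommGroup E] (c : E)
    (a b : ℝ) : AbsolutelyContinuousOnInterval (fun _ => c) a b := by
  simp [AbsolutelyContinuousOnInterval, tendsto_const_nhds]

/-- The squared distance of an absolutely continuous curve to a point is absolutely continuous. -/
theorem AbsolutelyContinuousOnInterval.norm_sub_sq {E : Type*} [NormedAddCommGroup E]
    {f : ℝ → E} {a b : ℝ} (hf : AbsolutelyContinuousOnInterval f a b) (v : E) :
    AbsolutelyContinuousOnInterval (fun x => ‖f x - v‖ ^ 2) a b := by
  have h := (hf.fun_sub (AbsolutelyContinuousOnInterval.const v a b)).norm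
  simpa only [sq] using h.fun_mul h

/-- An absolutely continuous function with almost everywhere nonpositive derivative decreases. -/
theorem AbsolutelyContinuousOnInterval.le_of_deriv_nonpos {f : ℝ → ℝ} {a b : ℝ} (hab : a ≤ b)
    (hf : AbsolutelyContinuousOnInterval f a b)
    (hd : ∀ᵐ x, x ∈ Ioo a b → deriv f x ≤ 0) : f b ≤ f a := by
  have h1 := hf.integral_deriv_eq_sub
  have h2 : 0 ≤ ∫ x in a..b, -deriv f x := by
    apply intervalIntegral.integral_nonneg_of_ae_restrict hab
    rw [Filter.EventuallyLE, ← restrict_Ioo_eq_restrict_Icc, ae_restrict_iff' measurableSet_Ioo]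
    filter_upwards [hd] with x hx hx'
    simpa using hx hx'
  rw [intervalIntegral.integral_neg] at h2
  linarith

/-- One implicit Euler step for a nonincreasing function with `G' ≤ -k G` almost everywhere. -/
theorem AntitoneOn.mul_one_add_le_of_deriv_le {G : ℝ → ℝ} {a b k : ℝ} (hab : a ≤ b) (hk : 0 ≤ k)
    (hG : AntitoneOn G (Icc a b))
    (hd : ∀ᵐ x, x ∈ Ioo a b → ∀ d, HasDerivAt G d x → d ≤ -(k * G x)) :
    G b * (1 + k * (b - a)) ≤ G a := by
  have hm : MonotoneOn (fun x => -G x) (uIcc a b) := by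
    rw [uIcc_of_le hab]; exact hG.neg
  have hGab : G b ≤ G a := hG (left_mem_Icc.2 hab) (right_mem_Icc.2 hab) hab
  -- For a monotone function the integral of the derivative is at most the increment: jumps and
  -- singular parts have the favourable sign.
  have h1 := hm.intervalIntegral_deriv_mem_uIcc
  rw [uIcc_of_le (by linarith)] at h1
  have h2 : ∫ _ in a..b, k * G b ≤ ∫ x in a..b, deriv (fun x => -G x) x := by
    apply intervalIntegral.integral_mono_ae_restrict hab (by simp) hm.intervalIntegrable_deriv
    rw [Filter.EventuallyLE, ← restrict_Ioo_eq_restrict_Icc, ae_restrict_iff' measurableSet_Ioo]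
    filter_upwards [hd, hm.ae_differentiableWithinAt_of_mem] with x hx hdx hx'
    have hxI : x ∈ Icc a b := Ioo_subset_Icc_self hx'
    rw [uIcc_of_le hab] at hdx
    have hD := ((hdx hxI).differentiableAt (Icc_mem_nhds hx'.1 hx'.2)).hasDerivAt
    have hD' : HasDerivAt G (-deriv (fun x => -G x) x) x :=
      hD.fun_neg.congr_of_eventuallyEq (Eventually.of_forall fun y => (neg_neg (G y)).symm)
    have h3 := hx hx' _ hD'
    have h4 : k * G b ≤ k * G x :=
      mul_le_mul_of_nonneg_left (hG hxI (right_mem_Icc.2 hab) hxI.2) hk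
    linarith
  rw [intervalIntegral.integral_const, smul_eq_mul] at h2
  linarith [h1.2]

/-- Grönwall's inequality for a nonincreasing, possibly discontinuous, function. -/
theorem AntitoneOn.mul_exp_le_of_deriv_le {G : ℝ → ℝ} {a b k : ℝ} (hab : a ≤ b) (hk : 0 ≤ k)
    (hG : AntitoneOn G (Icc a b))
    (hd : ∀ᵐ x, x ∈ Ioo a b → ∀ d, HasDerivAt G d x → d ≤ -(k * G x)) :
    G b * Real.exp (k * (b - a)) ≤ G a := by
  -- Compose `n` Euler steps of equal length; `(1 + k(b - a)/n)^n` tends to the exponential.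
  have key : ∀ n : ℕ, 0 < n → G b * (1 + k * (b - a) / n) ^ n ≤ G a := by
    intro n hn
    have hn' : (0 : ℝ) < n := by exact_mod_cast hn
    set δ := (b - a) / n with hδ
    have hδ0 : 0 ≤ δ := div_nonneg (sub_nonneg.2 hab) hn'.le
    have hδn : n * δ = b - a := by rw [hδ]; field_simp
    have hi : ∀ i : ℕ, i ≤ n → G (a + i * δ) * (1 + k * δ) ^ i ≤ G a := by
      intro i
      induction i with
      | zero => simp
      | succ i ih =>
        intro hin
        have hin' : ((i : ℝ) + 1) * δ ≤ n * δ :=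
          mul_le_mul_of_nonneg_right (by exact_mod_cast hin) hδ0
        have hiδ : 0 ≤ (i : ℝ) * δ := by positivity
        have hsub : Icc (a + i * δ) (a + (i + 1 : ℕ) * δ) ⊆ Icc a b :=
          Icc_subset_Icc (by linarith) (by push_cast; linarith)
        have hstep := AntitoneOn.mul_one_add_le_of_deriv_le
          (a := a + i * δ) (b := a + (i + 1 : ℕ) * δ) (by push_cast; linarith) hk
          (hG.mono hsub) (by
            filter_upwards [hd] with x hx hx'
            refine hx ⟨by linarith [hx'.1], ?_⟩
            have := hx'.2
            push_cast at this
            linarith)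
        have he : a + ((i + 1 : ℕ) : ℝ) * δ - (a + i * δ) = δ := by push_cast; ring
        rw [he] at hstep
        calc G (a + (i + 1 : ℕ) * δ) * (1 + k * δ) ^ (i + 1)
            = G (a + (i + 1 : ℕ) * δ) * (1 + k * δ) * (1 + k * δ) ^ i := by ring
          _ ≤ G (a + i * δ) * (1 + k * δ) ^ i := by gcongr
          _ ≤ G a := ih (by omega)
    have h := hi n le_rfl
    rw [hδn, add_sub_cancel, hδ, ← mul_div_assoc] at h
    exact h
  refine le_of_tendsto ((Real.tendsto_one_add_div_pow_exp (k * (b - a))).const_mul (G b)) ?_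
  filter_upwards [eventually_gt_atTop 0] with n hn using key n hn

/-! ### Weak differentiability of curves -/

section

variable {H : Type*} [NormedAddCommGroup H] [InnerProductSpace ℝ H]

/-- If all squared distances to points are differentiable along a curve, then the curve has
a weak derivative. -/
theorem exists_weak_deriv_of_norm_sub_sq [CompleteSpace H] {u : ℝ → H} {s : ℝ}
    (h : ∀ v : H, ∃ d : ℝ, HasDerivAt (fun r => ‖u r - v‖ ^ 2) d s) :
    ∃ w : H, ∀ v : H, HasDerivAt (fun r => ⟪u r, v⟫) ⟪w, v⟫ s := by
  have h1 : ∀ v : H, ∃ d : ℝ, HasDerivAt (fun r => ⟪u r, v⟫) d s := by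
    intro v
    obtain ⟨d, hd⟩ := h v
    obtain ⟨e, he⟩ := h 0
    -- Polarization: `2⟪u, v⟫ = ‖u‖² - ‖u - v‖² + ‖v‖²`.
    refine ⟨_, (((he.sub hd).add_const (‖v‖ ^ 2)).div_const 2).congr_of_eventuallyEq
      (Eventually.of_forall fun r => ?_)⟩
    simp only [Pi.sub_apply, sub_zero]
    rw [norm_sub_sq_real]; ring
  choose d hd using h1
  -- The difference quotients converge pointwise as functionals. By Banach–Steinhaus the limit is
  -- bounded, and Riesz represents it by a vector.
  let g : ℝ → H →L[ℝ] ℝ := fun r => innerSL ℝ ((r - s)⁻¹ • (u r - u s))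
  have hg : Tendsto (fun r x => g r x) (𝓝[≠] s) (𝓝 d) := by
    rw [tendsto_pi_nhds]
    intro v
    refine (hd v).tendsto_slope.congr fun r => ?_
    simp only [slope, vsub_eq_sub, smul_eq_mul, g, innerSL_apply_apply, real_inner_smul_left,
      inner_sub_left]
  refine ⟨(InnerProductSpace.toDual ℝ H).symm (continuousLinearMapOfTendsto g hg), fun v => ?_⟩
  rw [InnerProductSpace.toDual_symm_apply]
  exact hd v

/-- The derivative of the squared distance to a point in terms of the weak derivative. -/
theorem hasDerivAt_norm_sub_sq_eq_inner {u : ℝ → H} {s : ℝ} {w : H}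
    (hw : ∀ v : H, HasDerivAt (fun r => ⟪u r, v⟫) ⟪w, v⟫ s)
    (h : ∃ d : ℝ, HasDerivAt (fun r => ‖u r - u s‖ ^ 2) d s)
    {v : H} {d : ℝ} (hd : HasDerivAt (fun r => ‖u r - v‖ ^ 2) d s) :
    d = 2 * ⟪w, u s - v⟫ := by
  obtain ⟨e, he⟩ := h
  -- Expanding `‖u r - v‖²` around `u s` leaves the quadratic term `‖u r - u s‖²`, which weak
  -- differentiability does not control; being differentiable and minimal at `s`, it has derivative
  -- zero.
  have hmin : IsLocalMin (fun r => ‖u r - u s‖ ^ 2) s :=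
    Eventually.of_forall fun r => by simp
  have he0 : e = 0 := hmin.hasDerivAt_eq_zero he
  subst he0
  have h2 := ((he.add ((hw (u s - v)).const_mul 2)).add_const (‖v‖ ^ 2 - ‖u s‖ ^ 2))
  rw [zero_add] at h2
  refine hd.unique (h2.congr_of_eventuallyEq (Eventually.of_forall fun r => ?_))
  simp only [Pi.add_apply]
  rw [norm_sub_sq_real, norm_sub_sq_real, inner_sub_right]; ring

/-! ### Energy along the flow -/

namespace IsGradientFlow

variable {lam : ℝ} {Φ : H → EReal} {x₀ : H} {u : ℝ → H}

theorem evi_ae (hu : IsGradientFlow lam Φ x₀ u) :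
    ∀ᵐ t, 0 < t → ∀ v : H, ∃ d : ℝ, HasDerivAt (fun s : ℝ => ‖u s - v‖ ^ 2) d t ∧
      ((1 / 2 * d + 1 / 2 * lam * ‖u t - v‖ ^ 2 : ℝ) : EReal) + Φ (u t) ≤ Φ v :=
  (ae_restrict_iff' measurableSet_Ioi).1 hu.evi

/-- The functional decreases along its gradient flow. -/
theorem apply_le_apply (hu : IsGradientFlow lam Φ x₀ u) (hlam : 0 ≤ lam) (hbot : ∀ x, Φ x ≠ ⊥)
    (hlsc : LowerSemicontinuous Φ) {s t : ℝ} (hs : 0 < s) (hst : s ≤ t) :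
    Φ (u t) ≤ Φ (u s) := by
  by_contra! hlt
  have hac := hu.locallyAC s t hs hst
  have hcont : ContinuousOn u (Icc s t) := by simpa [uIcc_of_le hst] using hac.continuousOn
  -- Let `r` be the last time in `[s, t]` with energy at most `Φ (u s)`. After `r` the energy
  -- exceeds `Φ (u r)`, so the evolution inequality with `v = u r` prevents the curve from leaving
  -- `u r`.
  set S : Set ℝ := Icc s t ∩ u ⁻¹' (Φ ⁻¹' Iic (Φ (u s))) with hS
  have hSclosed : IsClosed S :=
    hcont.preimage_isClosed_of_isClosed isClosed_Icc (hlsc.isClosed_preimage _)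
  have hScomp : IsCompact S := isCompact_Icc.of_isClosed_subset hSclosed inter_subset_left
  have hrS := hScomp.sSup_mem ⟨s, left_mem_Icc.2 hst, le_refl (Φ (u s))⟩
  set r := sSup S
  obtain ⟨⟨hsr, hrt⟩, hr⟩ := hrS
  have hr : Φ (u r) ≤ Φ (u s) := hr
  have hgt : ∀ q ∈ Ioo r t, Φ (u s) < Φ (u q) := by
    intro q hq
    by_contra! hle
    exact absurd (le_csSup hScomp.bddAbove (show q ∈ S from ⟨⟨hsr.trans hq.1.le, hq.2.le⟩, hle⟩))
      (not_le.2 hq.1)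
  have h0 : ‖u t - u r‖ ^ 2 ≤ ‖u r - u r‖ ^ 2 := by
    refine AbsolutelyContinuousOnInterval.le_of_deriv_nonpos
      (f := fun q => ‖u q - u r‖ ^ 2) hrt
      ((hu.locallyAC r t (hs.trans_le hsr) hrt).norm_sub_sq (u r)) ?_
    filter_upwards [hu.evi_ae] with q hq hqI
    obtain ⟨d, hd, hle⟩ := hq (hs.trans_le (hsr.trans hqI.1.le)) (u r)
    rw [hd.deriv]
    have hlt' := hr.trans_lt (hgt q hqI)
    generalize Φ (u r) = A at hle hlt'
    have hB := hbot (u q)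
    generalize Φ (u q) = B at hle hlt' hB
    have hn : 0 ≤ lam * ‖u q - u r‖ ^ 2 := by positivity
    induction B with
    | bot => exact absurd rfl hB
    | top =>
      rw [EReal.coe_add_top, top_le_iff] at hle
      exact absurd hle hlt'.ne
    | coe b =>
      have := hle.trans_lt hlt'
      norm_cast at this
      linarith
  have h1 : u t = u r := by
    rw [sub_self, norm_zero] at h0
    exact sub_eq_zero.1 (norm_eq_zero.1 (pow_eq_zero_iff two_ne_zero |>.1
      (le_antisymm (by simpa using h0) (sq_nonneg _))))
  rw [h1] at hlt
  exact absurd hr (not_le.2 hlt)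

/-- Testing the evolution inequality with a point of the domain makes the energy finite at almost
every time; monotonicity extends this to every time. -/
theorem apply_ne_top (hu : IsGradientFlow lam Φ x₀ u) (hlam : 0 ≤ lam) (hbot : ∀ x, Φ x ≠ ⊥)
    (hproper : IsProperFun Φ) (hlsc : LowerSemicontinuous Φ) {t : ℝ} (ht : 0 < t) :
    Φ (u t) ≠ ⊤ := by
  obtain ⟨v, hv⟩ := hproper
  have hex : ∃ s ∈ Ioo 0 t, Φ (u s) ≠ ⊤ := by
    by_contra! hcon
    have hae : ∀ᵐ s, s ∉ Ioo 0 t := by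
      filter_upwards [hu.evi_ae] with s hs hmem
      obtain ⟨d, -, hle⟩ := hs hmem.1 v
      rw [hcon s hmem, EReal.coe_add_top, top_le_iff] at hle
      exact hv hle
    have : volume (Ioo 0 t) = 0 := measure_eq_zero_iff_ae_notMem.2 hae
    simp [Real.volume_Ioo] at this
    linarith
  obtain ⟨s, hs, hfin⟩ := hex
  exact ((hu.apply_le_apply hlam hbot hlsc hs.1 hs.2.le).trans_lt (lt_top_iff_ne_top.2 hfin)).ne

/-- At almost every time a gradient flow has a weak derivative whose opposite is
a subgradient. -/
theorem exists_subgradient [CompleteSpace H] (hu : IsGradientFlow lam Φ x₀ u)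
    (hlam : 0 ≤ lam) (hbot : ∀ x, Φ x ≠ ⊥)
    (hproper : IsProperFun Φ) (hlsc : LowerSemicontinuous Φ) :
    ∀ᵐ s, 0 < s → ∃ w : H, (∀ v : H, HasDerivAt (fun r => ⟪u r, v⟫) ⟪w, v⟫ s) ∧
      ∀ v : H, Φ v ≠ ⊤ →
        ⟪w, u s - v⟫ + lam / 2 * ‖u s - v‖ ^ 2 + (Φ (u s)).toReal ≤ (Φ v).toReal := by
  filter_upwards [hu.evi_ae] with s hs hpos
  have hs := hs hpos
  obtain ⟨w, hw⟩ := exists_weak_deriv_of_norm_sub_sq (u := u) (s := s)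
    fun v => (hs v).imp fun _ h => h.1
  refine ⟨w, hw, fun v hv => ?_⟩
  obtain ⟨d, hd, hle⟩ := hs v
  have hdw := hasDerivAt_norm_sub_sq_eq_inner hw ((hs (u s)).imp fun _ h => h.1) hd
  rw [← EReal.coe_toReal hv (hbot v),
    ← EReal.coe_toReal (hu.apply_ne_top hlam hbot hproper hlsc hpos) (hbot (u s))] at hle
  norm_cast at hle
  rw [hdw] at hle
  linarith

/-- The energy dissipation inequality, in the form of an exponential decay of energy gaps. -/
theorem energy_gap_mul_exp_le [CompleteSpace H] (hu : IsGradientFlow lam Φ x₀ u)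
    (hlam : 0 ≤ lam) (hbot : ∀ x, Φ x ≠ ⊥)
    (hproper : IsProperFun Φ) (hlsc : LowerSemicontinuous Φ) {x : H} (hx : Φ x ≠ ⊤)
    {s t : ℝ} (hs : 0 < s) (hst : s ≤ t) :
    ((Φ (u t)).toReal - (Φ x).toReal) * Real.exp (2 * lam * (t - s)) ≤
      (Φ (u s)).toReal - (Φ x).toReal := by
  have hfin : ∀ r, 0 < r → Φ (u r) ≠ ⊤ := fun r hr =>
    hu.apply_ne_top hlam hbot hproper hlsc hr
  refine AntitoneOn.mul_exp_le_of_deriv_le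
    (G := fun r => (Φ (u r)).toReal - (Φ x).toReal) hst (by positivity) ?_ ?_
  · intro p hp q hq hpq
    exact sub_le_sub_right (EReal.toReal_le_toReal
      (hu.apply_le_apply hlam hbot hlsc (hs.trans_le hp.1) hpq) (hbot _)
      (hfin p (hs.trans_le hp.1))) _
  · filter_upwards [hu.exists_subgradient hlam hbot hproper hlsc] with r hr hrI d hd
    have hr0 : 0 < r := hs.trans hrI.1
    obtain ⟨w, hw, hsub⟩ := hr hr0
    have hd' : HasDerivAt (fun q => (Φ (u q)).toReal) d r := by
      simpa using hd.add_const (Φ x).toReal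
    -- Only left difference quotients serve: dividing the subgradient inequality by `q - r < 0`
    -- bounds the slope of the energy from above.
    have hlt : 𝓝[<] r ≤ 𝓝[≠] r := nhdsWithin_mono r fun y (hy : y < r) => hy.ne
    have hdw : d ≤ -⟪w, w⟫ := by
      refine le_of_tendsto_of_tendsto
        (hd'.tendsto_slope.mono_left hlt) ((hw w).tendsto_slope.neg.mono_left hlt) ?_
      filter_upwards [Ioo_mem_nhdsLT hr0] with q hq
      have h1 := hsub (u q) (hfin q hq.1)
      have h2 : 0 ≤ lam / 2 * ‖u r - u q‖ ^ 2 := by positivity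
      have h3 : ⟪w, u r - u q⟫ = ⟪u r, w⟫ - ⟪u q, w⟫ := by
        rw [real_inner_comm, inner_sub_left]
      rw [slope_def_field, slope_def_field, ← neg_div]
      exact div_le_div_of_nonpos_of_le (by linarith [hq.2]) (by linarith)
    have h1 := hsub x hx
    -- Multiplying `h1` by `2 lam` and completing the square gives `2 lam E ≤ ‖w‖²`, without
    -- dividing by `lam`.
    have h2 : 0 ≤ ‖w + lam • (u r - x)‖ ^ 2 := sq_nonneg _
    rw [norm_add_sq_real, real_inner_smul_right, norm_smul, Real.norm_of_nonneg hlam] at h2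
    rw [real_inner_self_eq_norm_sq] at hdw
    have h3 := mul_le_mul_of_nonneg_left h1 hlam
    nlinarith

end IsGradientFlow

end

/-! ### The factor `kappa` and the regularizing estimate -/

/-- This is how `kappa` arises: it is the total weight of the decay factors, for zero and nonzero
`lam` alike. -/
theorem integral_exp_eq_kappa (t lam : ℝ) :
    ∫ r in (0 : ℝ)..t, Real.exp (2 * lam * (t - r)) = kappa t lam := by
  rw [intervalIntegral.integral_comp_sub_left (fun r => Real.exp (2 * lam * r)) t, sub_self,
    sub_zero, kappa]
  split_ifs with h
  · simp [h]
  · rw [intervalIntegral.integral_comp_mul_left (fun r => Real.exp r)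
      (mul_ne_zero two_ne_zero h), integral_exp, mul_zero, Real.exp_zero, smul_eq_mul]
    field_simp

theorem kappa_pos {t lam : ℝ} (ht : 0 < t) : 0 < kappa t lam := by
  rw [← integral_exp_eq_kappa]
  exact intervalIntegral.intervalIntegral_pos_of_pos
    (Continuous.intervalIntegrable (by fun_prop) _ _) (fun _ => Real.exp_pos _) ht

theorem tendsto_kappa_atTop {lam : ℝ} (hlam : 0 ≤ lam) :
    Tendsto (fun t => kappa t lam) atTop atTop := by
  rcases hlam.eq_or_lt with rfl | hpos
  · simpa [kappa] using! tendsto_id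
  · simp only [kappa, hpos.ne', if_false]
    refine Tendsto.atTop_div_const (by positivity) (tendsto_atTop_add_const_right _ _ ?_)
    exact Real.tendsto_exp_atTop.comp (tendsto_id.const_mul_atTop (by positivity))

/-- The regularizing estimate, for real values of the functional. -/
theorem IsGradientFlow.energy_gap_mul_kappa_le {H : Type*} [NormedAddCommGroup H]
    [InnerProductSpace ℝ H] [CompleteSpace H] {lam : ℝ} {Φ : H → EReal}
    {x₀ : H} {u : ℝ → H} (hu : IsGradientFlow lam Φ x₀ u)
    (hlam : 0 ≤ lam) (hbot : ∀ x, Φ x ≠ ⊥)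
    (hproper : IsProperFun Φ) (hlsc : LowerSemicontinuous Φ) {x : H} (hx : Φ x ≠ ⊤)
    {t : ℝ} (ht : 0 < t) :
    ((Φ (u t)).toReal - (Φ x).toReal) * kappa t lam ≤ 1 / 2 * ‖x₀ - x‖ ^ 2 := by
  set c := (Φ (u t)).toReal - (Φ x).toReal with hc
  set P : ℝ → ℝ := fun s => ∫ r in (0 : ℝ)..s, Real.exp (2 * lam * (t - r)) with hP
  have hPd : ∀ s, HasDerivAt P (Real.exp (2 * lam * (t - s))) s := fun s =>
    intervalIntegral.integral_hasDerivAt_right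
      (Continuous.intervalIntegrable (by fun_prop) _ _)
      (Continuous.stronglyMeasurableAtFilter (by fun_prop) _ _)
      (Continuous.continuousAt (by fun_prop))
  have hPac : ∀ a, AbsolutelyContinuousOnInterval P a t := fun a => by
    refine ContDiffOn.absolutelyContinuousOnInterval (ContDiff.contDiffOn ?_)
    rw [contDiff_one_iff_deriv]
    refine ⟨fun s => (hPd s).differentiableAt, ?_⟩
    rw [funext fun s => (hPd s).deriv]
    fun_prop
  -- `‖u r - x‖²/2 + c P(r)` is nonincreasing along the flow. Absolute continuity is available only
  -- away from `0`, so the start `s` is positive and tends to `0` afterwards.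
  have key : ∀ s ∈ Ioo 0 t, c * kappa t lam ≤ 1 / 2 * ‖u s - x‖ ^ 2 + c * P s := by
    intro s hs
    have h := AbsolutelyContinuousOnInterval.le_of_deriv_nonpos
      (f := fun r => 1 / 2 * ‖u r - x‖ ^ 2 + c * P r) hs.2.le
      ((((hu.locallyAC s t hs.1 hs.2.le).norm_sub_sq x).const_mul (1 / 2)).fun_add
        ((hPac s).const_mul c)) (by
      filter_upwards [hu.evi_ae] with r hr hrI
      have hr0 : 0 < r := hs.1.trans hrI.1
      obtain ⟨d, hd, hle⟩ := hr hr0 x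
      rw [((hd.const_mul (1 / 2)).fun_add ((hPd r).const_mul c)).deriv]
      rw [← EReal.coe_toReal hx (hbot x),
        ← EReal.coe_toReal (hu.apply_ne_top hlam hbot hproper hlsc hr0) (hbot (u r))] at hle
      norm_cast at hle
      have h1 := hu.energy_gap_mul_exp_le hlam hbot hproper hlsc hx hr0 hrI.2.le
      have h2 : 0 ≤ lam * ‖u r - x‖ ^ 2 := by positivity
      linarith)
    have hPt : P t = kappa t lam := integral_exp_eq_kappa t lam
    rw [← hPt]
    have h2 : 0 ≤ ‖u t - x‖ ^ 2 := sq_nonneg _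
    linarith
  have hlim : Tendsto (fun s => 1 / 2 * ‖u s - x‖ ^ 2 + c * P s) (𝓝[>] 0)
      (𝓝 (1 / 2 * ‖x₀ - x‖ ^ 2 + c * P 0)) :=
    (((hu.initial.sub_const x).norm.pow 2).const_mul _).add
      (((hPd 0).continuousAt.tendsto.mono_left nhdsWithin_le_nhds).const_mul c)
  have hP0 : P 0 = 0 := by simp [hP]
  rw [hP0, mul_zero, add_zero] at hlim
  exact ge_of_tendsto hlim (by filter_upwards [Ioo_mem_nhdsGT ht] with s hs using key s hs)

theorem mainTheorem8 {H : Type*} [NormedAddCommGroup H] [InnerProductSpace ℝ H] [CompleteSpace H]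
    (lam : ℝ) (hlam : 0 ≤ lam)
    (Φ : H → EReal) (hΦ_bot : ∀ x, Φ x ≠ ⊥) (hΦ_proper : IsProperFun Φ)
    (hΦ_conv : LambdaConvex lam Φ) (hΦ_lsc : LowerSemicontinuous Φ)
    (x₀ : H) (hx₀ : x₀ ∈ closure (effDom Φ))
    (u : ℝ → H) (hu : IsGradientFlow lam Φ x₀ u) :
    (∀ t : ℝ, 0 < t → Φ (u t) ≠ ⊤) ∧
    (∀ x : H, ∀ t : ℝ, 0 < t →
      Φ (u t) - Φ x ≤ ((1 / (2 * kappa t lam) * ‖x₀ - x‖ ^ 2 : ℝ) : EReal)) ∧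
    Tendsto (fun t : ℝ => kappa t lam) atTop atTop ∧
    (∀ xs : H, (∀ y : H, Φ xs ≤ Φ y) → Tendsto (fun t : ℝ => Φ (u t)) atTop (𝓝 (Φ xs))) := by
  have hfin : ∀ t : ℝ, 0 < t → Φ (u t) ≠ ⊤ := fun t ht =>
    hu.apply_ne_top hlam hΦ_bot hΦ_proper hΦ_lsc ht
  have hreal : ∀ x : H, Φ x ≠ ⊤ → ∀ t : ℝ, 0 < t →
      (Φ (u t)).toReal - (Φ x).toReal ≤ 1 / (2 * kappa t lam) * ‖x₀ - x‖ ^ 2 := by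
    intro x hx t ht
    have hk := kappa_pos (lam := lam) ht
    have h := hu.energy_gap_mul_kappa_le hlam hΦ_bot hΦ_proper hΦ_lsc hx ht
    rw [← le_div_iff₀ hk] at h
    refine h.trans_eq ?_
    field_simp
  refine ⟨hfin, fun x t ht => ?_, tendsto_kappa_atTop hlam, fun xs hmin => ?_⟩
  · by_cases hx : Φ x = ⊤
    · simp [hx]
    · rw [← EReal.coe_toReal hx (hΦ_bot x), ← EReal.coe_toReal (hfin t ht) (hΦ_bot (u t))]
      exact_mod_cast hreal x hx t ht
  · obtain ⟨v, hv⟩ := hΦ_proper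
    have hxs : Φ xs ≠ ⊤ := ((hmin v).trans_lt (lt_top_iff_ne_top.2 hv)).ne
    have hlim : Tendsto (fun t => (Φ xs).toReal + 1 / (2 * kappa t lam) * ‖x₀ - xs‖ ^ 2) atTop
        (𝓝 ((Φ xs).toReal)) := by
      have h1 : Tendsto (fun t => 1 / (2 * kappa t lam)) atTop (𝓝 0) :=
        tendsto_const_nhds.div_atTop
          ((tendsto_kappa_atTop hlam).const_mul_atTop (by norm_num))
      simpa using (h1.mul_const (‖x₀ - xs‖ ^ 2)).const_add (Φ xs).toReal
    have hlim' := (continuous_coe_real_ereal.tendsto _).comp hlim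
    rw [EReal.coe_toReal hxs (hΦ_bot xs)] at hlim'
    refine tendsto_of_tendsto_of_tendsto_of_le_of_le' tendsto_const_nhds hlim'
      (Eventually.of_forall fun t => hmin (u t)) ?_
    filter_upwards [eventually_gt_atTop 0] with t ht
    rw [← EReal.coe_toReal (hfin t ht) (hΦ_bot (u t))]
    exact EReal.coe_le_coe_iff.2 (by linarith [hreal xs hxs t ht])
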